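/- Let $d\ge 2$ and let $\{\Pi_j\}$ be a minimal informationally complete (IC) measurement in dimension $d$: $d^2$ positive semidefinite operators on $\mathbb{C}^d$ with $\sum_j\Pi_j=1$ that span the space of all operators. Let $\wp=\sum_j\frac{\operatorname{tr}(\Pi_j)}{d}\,\frac{\operatorname{tr}(\Pi_j^2)}{[\operatorname{tr}(\Pi_j)]^2}$ be its average purity (then $d^2\wp-d>0$). Let $N\ge1$ copies of an unknown state $\rho$ be measured independently, each outcome $j$ occurring with probability $p_j=\operatorname{tr}(\Pi_j\rho)$. An estimator $\hat\rho$ is an operator-valued function of the $N$ outcomes; it is unbiased if $\mathbb{E}_\rho[\hat\rho]=\rho$ for every state $\rho$, and its scaled MSE at $\rho$ is $\mathcal{E}_{\hat\rho}(\rho)=N\,\mathbb{E}_\rho\|\hat\rho-\rho\|_{\mathrm{HS}}^2$, where $\|A\|_{\mathrm{HS}}^2=\operatorname{tr}(A^\dagger A)$. (1) For every unbiased estimator $\hat\rho$ and every state $\rho$, the maximal scaled MSE over unitarily equivalent states exists and satisfies $$\max_{U\ \text{unitary}}\mathcal{E}_{\hat\rho}(U\rho U^\dagger)\ \ge\ \frac{(d^2-1)^2}{d^2\wp-d}-\Bigl[\operatorname{tr}(\rho^2)-\frac1d\Bigr].$$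 (2) The bound can be saturated if and only if the measurement is a generalized SIC, that is, $d^2\operatorname{tr}(\Pi_j\Pi_k)=\alpha\delta_{jk}+\zeta$ for all $j,k$ and some real constants $\alpha,\zeta$. More precisely, if the measurement is a generalized SIC, then some unbiased estimator with Hermitian values attains equality in (1) for every state $\rho$; and for each state $\rho\neq 1/d$, there is an unbiased estimator that attains equality at $\rho$ if and only if the measurement is a generalized SIC. -/

import Mathlib

open scoped Matrix ComplexOrder

namespace Tomography

noncomputable section

/-- A generalized measurement on a `d`-level system with outcomes labelled by `ι`: positive
operators that sum up to the identity. -/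
structure Measurement (d : ℕ) (ι : Type*) [Fintype ι] where
  /-- the outcome operators -/
  op : ι → Matrix (Fin d) (Fin d) ℂ
  posSemidef : ∀ j, (op j).PosSemidef
  sum_eq_one : ∑ j, op j = 1

/-- Quantum states: positive operators of trace one. -/
def IsState {d : ℕ} (ρ : Matrix (Fin d) (Fin d) ℂ) : Prop :=
  ρ.PosSemidef ∧ ρ.trace = 1

/-- The completely mixed state `1/d`. -/
def mixedState (d : ℕ) : Matrix (Fin d) (Fin d) ℂ :=
  (d : ℂ)⁻¹ • (1 : Matrix (Fin d) (Fin d) ℂ)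

/-- The squared Hilbert-Schmidt norm `tr (Aᴴ A)`. -/
def hsNormSq {d : ℕ} (A : Matrix (Fin d) (Fin d) ℂ) : ℝ :=
  (Aᴴ * A).trace.re

/-- The state `U ρ U†`. -/
def conjU {d : ℕ} (U : Matrix.unitaryGroup (Fin d) ℂ) (ρ : Matrix (Fin d) (Fin d) ℂ) :
    Matrix (Fin d) (Fin d) ℂ :=
  (U : Matrix (Fin d) (Fin d) ℂ) * ρ * (U : Matrix (Fin d) (Fin d) ℂ)ᴴ

namespace Measurement

variable {d : ℕ} {ι : Type*} [Fintype ι] (M : Measurement d ι)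

/-- Informational completeness: the outcomes span the whole operator space. -/
def IsIC : Prop :=
  Submodule.span ℂ (Set.range M.op) = ⊤

/-- A minimal IC measurement: an IC measurement with exactly `d²` outcomes. -/
def IsMinimalIC : Prop :=
  M.IsIC ∧ Fintype.card ι = d ^ 2

/-- The purity `tr (Π_j²) / (tr Π_j)²` of an outcome. -/
def purity (j : ι) : ℝ :=
  (M.op j * M.op j).trace.re / (M.op j).trace.re ^ 2

/-- The average purity `∑ j, (tr Π_j / d) ℘_j` of the measurement. -/
def avgPurity : ℝ :=
  ∑ j, (M.op j).trace.re / d * M.purity j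

/-- A generalized SIC: an IC measurement such that the operators `P_j = d Π_j` satisfy
`tr (P_j P_k) = α δ_{jk} + ζ` for some real constants `α` and `ζ`. -/
def IsGeneralizedSIC : Prop :=
  M.IsIC ∧ ∃ α ζ : ℝ,
    (∀ j, (((d : ℂ) • M.op j) * ((d : ℂ) • M.op j)).trace = ((α + ζ : ℝ) : ℂ)) ∧
    (∀ j k, j ≠ k → (((d : ℂ) • M.op j) * ((d : ℂ) • M.op k)).trace = (ζ : ℂ))

/-- Born rule: the probability `tr (Π_j ρ)` of the outcome `j`. -/
def prob (ρ : Matrix (Fin d) (Fin d) ℂ) (j : ι) : ℝ :=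
  (M.op j * ρ).trace.re

/-- The probability of the record `x` when `N` copies of `ρ` are measured independently. -/
def recordProb (ρ : Matrix (Fin d) (Fin d) ℂ) {N : ℕ} (x : Fin N → ι) : ℝ :=
  ∏ i, M.prob ρ (x i)

/-- Unbiasedness of an estimator, that is, of an operator-valued function of the record of the `N`
outcomes: its expectation is the true state, whatever this state is. -/
def IsUnbiased {N : ℕ} (est : (Fin N → ι) → Matrix (Fin d) (Fin d) ℂ) : Prop :=
  ∀ ρ : Matrix (Fin d) (Fin d) ℂ, IsState ρ →
    ∑ x : Fin N → ι, (M.recordProb ρ x : ℂ) • est x = ρ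

/-- The scaled mean square error: `N` times the expected squared Hilbert-Schmidt distance between
the estimator and the true state. -/
def scaledMSE {N : ℕ} (est : (Fin N → ι) → Matrix (Fin d) (Fin d) ℂ)
    (ρ : Matrix (Fin d) (Fin d) ℂ) : ℝ :=
  N * ∑ x : Fin N → ι, M.recordProb ρ x * hsNormSq (est x - ρ)

/-- `m` is the maximal scaled mean square error over all states unitarily equivalent to `ρ`. -/
def IsMaxScaledMSE {N : ℕ} (est : (Fin N → ι) → Matrix (Fin d) (Fin d) ℂ)
    (ρ : Matrix (Fin d) (Fin d) ℂ) (m : ℝ) : Prop :=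
  IsGreatest (Set.range fun U : Matrix.unitaryGroup (Fin d) ℂ => M.scaledMSE est (conjU U ρ)) m

/-- The tomographic bound `(d² - 1)² / (d² ℘ - d) - (tr ρ² - 1/d)`. -/
def mseBound (ρ : Matrix (Fin d) (Fin d) ℂ) : ℝ :=
  ((d : ℝ) ^ 2 - 1) ^ 2 / ((d : ℝ) ^ 2 * M.avgPurity - d) - ((ρ * ρ).trace.re - 1 / (d : ℝ))

end Measurement

end

end Tomography

/-!
Write `a_j = tr Π_j` and let `Θ_j` be the basis dual to the outcomes `Π_j` under the trace pairing;
these operators are Hermitian, have trace one, and satisfy `ρ = ∑ j, tr (Π_j ρ) Θ_j`.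

*The optimal estimator.* The average of `Θ_j` over the observed outcomes is unbiased, and its scaled
error at `ρ` is `tr (F ρ) - tr ρ²` with `F = ∑ j, ‖Θ_j‖² Π_j` (`IsDual.scaledMSE_meanEstimator`). It
is optimal at every state (`IsUnbiased.le_scaledMSE`): its difference `h` with another unbiased
estimator has a vanishing expectation for all states. As this expectation is a homogeneous polynomial
in the outcome probabilities, and the outcomes are linearly independent, it vanishes for arbitrary
real weights on the outcomes (`IsUnbiased.sum_prod_mul_sub_eq_zero`). Differentiating with respect to
the weights shows that `h` is uncorrelated with every additive statistic
(`sum_prod_mul_sum_eq_zero`), in particular with the mean estimator. No Fisher information is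
inverted, so states with vanishing outcome probabilities need no separate treatment.

*The unitary orbit.* In eigenbases, `tr (F U ρ U†)` takes all the values `∑ i, f_i D_{σ i}` for
permutations `σ`, where `f` and `D` are the spectra of `F` and `ρ`. Averaging over cyclic shifts gives
a unitary with `tr (F U ρ U†) ≥ tr F / d` (`exists_conjU_trace_ge`), and if `ρ` is not completely
mixed, then `tr F / d` is the maximum only if `F` is a multiple of the identity
(`eq_smul_one_of_conjU_trace_le`).

*The frame bound.* For real `t`, the sum of squares
`∑ j, a_j ‖(Θ_j - 1/d) - t (Π_j / a_j - 1/d)‖² = (tr F - 1) - 2 t (d² - 1) + t² (d ℘ - 1)`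
is nonnegative (`IsDual.sum_hsNormSq_dualDefect`), which forces `d ℘ > 1` and
`tr F - 1 ≥ (d² - 1)² / (d ℘ - 1)`, that is, the tomographic bound.

*Equality.* If the bound is attained at `ρ ≠ 1/d`, then `F` is a multiple of the identity, so that all
`‖Θ_j‖` agree, and the sum of squares vanishes for the optimal `t`, so that each `Θ_j` is an affine
function of `Π_j`. Together these make all `a_j` equal and give the Gram matrix of a generalized SIC
(`IsDual.isGeneralizedSIC`). Conversely, for a generalized SIC the dual basis is explicit, and the
mean estimator has the error `mseBound ρ` at all states of the orbit
(`IsGeneralizedSIC.hsNormSq_sub`).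
-/

namespace Tomography

/-! ### Independent samples -/

section Samples

variable {ι : Type*} [Fintype ι] {N : ℕ}

lemma sum_prod_apply (φ : Fin N → ι → ℂ) :
    ∑ x : Fin N → ι, ∏ i, φ i (x i) = ∏ i, ∑ j, φ i j := by
  rw [Finset.prod_univ_sum, Fintype.piFinset_univ]

lemma sum_prod_mul_apply (p : ι → ℂ) (hp : ∑ j, p j = 1) (u : ι → ℂ) (k : Fin N) :
    ∑ x : Fin N → ι, (∏ i, p (x i)) * u (x k) = ∑ j, p j * u j := by
  have h := sum_prod_apply (N := N) (fun i j => p j * if i = k then u j else 1)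
  rw [Finset.prod_eq_single k] at h
  · simpa [Finset.prod_mul_distrib, -mul_ite] using h
  · intro i _ hik
    simpa [hik] using hp
  · simp

lemma sum_prod_mul_apply_mul_apply (p : ι → ℂ) (hp : ∑ j, p j = 1) (u v : ι → ℂ)
    {k l : Fin N} (hkl : k ≠ l) :
    ∑ x : Fin N → ι, (∏ i, p (x i)) * (u (x k) * v (x l)) =
      (∑ j, p j * u j) * ∑ j, p j * v j := by
  have h := sum_prod_apply (N := N)
    (fun i j => p j * ((if i = k then u j else 1) * if i = l then v j else 1))
  rw [Finset.prod_eq_mul k l hkl] at h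
  · simpa [Finset.prod_mul_distrib, hkl, hkl.symm, -mul_ite, -ite_mul] using h
  · intro i _ hik
    simpa [hik.1, hik.2] using hp
  · simp
  · simp

/-- The variance of a sum of independent centred samples is the sum of the variances. -/
lemma sum_prod_mul_normSq_sum (p : ι → ℝ) (hp : ∑ j, p j = 1) (u : ι → ℂ)
    (hu : ∑ j, (p j : ℂ) * u j = 0) :
    ∑ x : Fin N → ι, (∏ i, p (x i)) * Complex.normSq (∑ i, u (x i)) =
      N * ∑ j, p j * Complex.normSq (u j) := by
  have hp' : ∑ j, (p j : ℂ) = 1 := by exact_mod_cast hp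
  have key : ∀ k l : Fin N, ∑ x : Fin N → ι, (∏ i, (p (x i) : ℂ)) *
      (star (u (x k)) * u (x l)) = if k = l then ∑ j, (p j : ℂ) * (star (u j) * u j) else 0 := by
    intro k l
    split_ifs with h
    · subst h
      exact sum_prod_mul_apply _ hp' (fun j => star (u j) * u j) k
    · rw [sum_prod_mul_apply_mul_apply (fun j => (p j : ℂ)) hp' (fun j => star (u j)) u h, hu,
        mul_zero]
  rw [← Complex.ofReal_inj]
  push_cast
  simp only [Complex.normSq_eq_conj_mul_self, map_sum, Finset.sum_mul_sum]
  simp only [Finset.mul_sum]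
  rw [Finset.sum_comm]
  simp_rw [Finset.sum_comm (s := (Finset.univ : Finset (Fin N → ι)))]
  simp only [Complex.star_def] at key
  simp [key, Finset.mul_sum]

/-- The scaled variance of the sample mean. -/
lemma scaled_variance_mean (hN : 1 ≤ N) (p : ι → ℝ) (hp : ∑ j, p j = 1) (w : ι → ℂ) :
    N * ∑ x : Fin N → ι, (∏ i, p (x i)) *
        Complex.normSq ((N : ℂ)⁻¹ * ∑ i, w (x i) - ∑ j, (p j : ℂ) * w j) =
      ∑ j, p j * Complex.normSq (w j) - Complex.normSq (∑ j, (p j : ℂ) * w j) := by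
  set r := ∑ j, (p j : ℂ) * w j with hr
  have hN0 : (N : ℝ) ≠ 0 := by positivity
  have hN0' : (N : ℂ) ≠ 0 := by exact_mod_cast hN0
  have hp' : ∑ j, (p j : ℂ) = 1 := by exact_mod_cast hp
  have hc := sum_prod_mul_normSq_sum (N := N) p hp (fun j => w j - r)
    (by simp only [mul_sub, Finset.sum_sub_distrib, ← Finset.sum_mul, hp', one_mul]
        rw [← hr, sub_self])
  have h1 : ∀ x : Fin N → ι, Complex.normSq ((N : ℂ)⁻¹ * ∑ i, w (x i) - r) =
      ((N : ℝ) ^ 2)⁻¹ * Complex.normSq (∑ i, (w (x i) - r)) := by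
    intro x
    have : (N : ℂ)⁻¹ * ∑ i, w (x i) - r = (N : ℂ)⁻¹ * ∑ i, (w (x i) - r) := by
      simp [mul_sub, hN0']
    rw [this, Complex.normSq_mul, Complex.normSq_inv, Complex.normSq_natCast, sq]
  have h2 : ∑ j, p j * Complex.normSq (w j - r) =
      ∑ j, p j * Complex.normSq (w j) - Complex.normSq r := by
    have h3 : ∑ j, p j * (w j * star r).re = Complex.normSq r := by
      have : (r * star r).re = Complex.normSq r := by
        rw [Complex.star_def, Complex.mul_conj]; simp
      rw [← this]
      conv_rhs => rw [hr, Finset.sum_mul, Complex.re_sum]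
      refine Finset.sum_congr rfl fun j _ => ?_
      rw [mul_assoc, Complex.re_ofReal_mul]
    simp only [Complex.normSq_sub, mul_sub, mul_add, Finset.sum_sub_distrib,
      Finset.sum_add_distrib, ← Finset.sum_mul, hp]
    have h4 : ∑ j, p j * (2 * (w j * star r).re) = 2 * Complex.normSq r := by
      rw [← h3, Finset.mul_sum]
      exact Finset.sum_congr rfl fun j _ => by ring
    simp only [Complex.star_def] at h4
    rw [h4]; ring
  simp only [h1]
  simp only [mul_left_comm _ ((N : ℝ) ^ 2)⁻¹]
  rw [← Finset.mul_sum, hc, h2]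
  field_simp

lemma mean_mean (hN : 1 ≤ N) (p : ι → ℂ) (hp : ∑ j, p j = 1) (w : ι → ℂ) :
    ∑ x : Fin N → ι, (∏ i, p (x i)) * ((N : ℂ)⁻¹ * ∑ i, w (x i)) = ∑ j, p j * w j := by
  have hN0 : (N : ℂ) ≠ 0 := by exact_mod_cast (by lia : N ≠ 0)
  calc _ = (N : ℂ)⁻¹ * ∑ i : Fin N, ∑ x : Fin N → ι, (∏ i, p (x i)) * w (x i) := by
        rw [Finset.sum_comm, Finset.mul_sum]
        simp only [← Finset.mul_sum, mul_left_comm _ (N : ℂ)⁻¹]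
    _ = _ := by simp [sum_prod_mul_apply p hp w, hN0]

/-- A statistic whose expectation vanishes for all (real, unnormalized) weights is uncorrelated
with every additive statistic. This is seen by differentiating along `p j * exp (t * w j)`, so that
no weight has to be nonzero. -/
lemma sum_prod_mul_sum_eq_zero (g : (Fin N → ι) → ℂ)
    (hg : ∀ p : ι → ℝ, ∑ x, (∏ i, (p (x i) : ℂ)) * g x = 0) (p : ι → ℝ) (w : ι → ℂ) :
    ∑ x, (∏ i, (p (x i) : ℂ)) * (∑ i, w (x i)) * g x = 0 := by
  have real (w : ι → ℝ) : ∑ x, (∏ i, (p (x i) : ℂ)) * (∑ i, (w (x i) : ℂ)) * g x = 0 := by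
    have h0 : ∀ t : ℝ, ∑ x, (∏ i, (p (x i) : ℂ)) *
        Complex.exp ((∑ i, (w (x i) : ℂ)) * t) * g x = 0 := by
      intro t
      rw [← hg fun j => p j * Real.exp (w j * t)]
      refine Finset.sum_congr rfl fun x _ => ?_
      push_cast
      rw [Finset.prod_mul_distrib, Finset.sum_mul, Complex.exp_sum]
    have hd : HasDerivAt (fun t : ℝ => ∑ x, (∏ i, (p (x i) : ℂ)) *
        Complex.exp ((∑ i, (w (x i) : ℂ)) * t) * g x)
        (∑ x, (∏ i, (p (x i) : ℂ)) * (∑ i, (w (x i) : ℂ)) * g x) 0 := by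
      refine HasDerivAt.fun_sum fun x _ => ?_
      refine HasDerivAt.mul_const (HasDerivAt.const_mul _ ?_) _
      have h1 : HasDerivAt (fun t : ℝ => (∑ i, (w (x i) : ℂ)) * (t : ℂ))
          ((∑ i, (w (x i) : ℂ)) * 1) 0 := (Complex.ofRealCLM.hasDerivAt).const_mul _
      simpa using h1.cexp
    simp only [h0] at hd
    exact (hd.unique (hasDerivAt_const 0 0))
  have h1 := real fun j => (w j).re
  have h2 := real fun j => (w j).im
  have : ∀ x : Fin N → ι, ∑ i, w (x i) =
      ∑ i, ((w (x i)).re : ℂ) + Complex.I * ∑ i, ((w (x i)).im : ℂ) := by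
    intro x
    rw [Finset.mul_sum, ← Finset.sum_add_distrib]
    exact Finset.sum_congr rfl fun i _ => by rw [mul_comm, Complex.re_add_im]
  calc _ = ∑ x, (∏ i, (p (x i) : ℂ)) * (∑ i, ((w (x i)).re : ℂ)) * g x + Complex.I *
      ∑ x, (∏ i, (p (x i) : ℂ)) * (∑ i, ((w (x i)).im : ℂ)) * g x := by
        rw [Finset.mul_sum, ← Finset.sum_add_distrib]
        exact Finset.sum_congr rfl fun x _ => by rw [this]; ring
    _ = 0 := by rw [h1, h2]; simp

/-- Among all estimators with the same expectation as the sample mean of `w`, the sample mean has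
the least variance. -/
lemma mean_variance_le (hN : 1 ≤ N) (p : ι → ℝ) (hp0 : ∀ j, 0 ≤ p j) (hp : ∑ j, p j = 1)
    (w : ι → ℂ) (z : (Fin N → ι) → ℂ)
    (hz : ∀ q : ι → ℝ,
      ∑ x, (∏ i, (q (x i) : ℂ)) * (z x - (N : ℂ)⁻¹ * ∑ i, w (x i)) = 0) :
    ∑ j, p j * Complex.normSq (w j) - Complex.normSq (∑ j, (p j : ℂ) * w j) ≤
      N * ∑ x : Fin N → ι, (∏ i, p (x i)) *
        Complex.normSq (z x - ∑ j, (p j : ℂ) * w j) := by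
  rw [← scaled_variance_mean hN p hp w]
  refine mul_le_mul_of_nonneg_left ?_ (Nat.cast_nonneg N)
  set r := ∑ j, (p j : ℂ) * w j
  set h : (Fin N → ι) → ℂ := fun x => z x - (N : ℂ)⁻¹ * ∑ i, w (x i) with hh
  have horth : ∑ x, (∏ i, (p (x i) : ℂ)) *
      (h x * star ((N : ℂ)⁻¹ * ∑ i, w (x i) - r)) = 0 := by
    have h1 := sum_prod_mul_sum_eq_zero h hz p (fun j => star (w j))
    have h2 := hz p
    have : ∀ x : Fin N → ι, (∏ i, (p (x i) : ℂ)) *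
        (h x * star ((N : ℂ)⁻¹ * ∑ i, w (x i) - r)) =
        (N : ℂ)⁻¹ * ((∏ i, (p (x i) : ℂ)) * (∑ i, star (w (x i))) * h x) -
          star r * ((∏ i, (p (x i) : ℂ)) * h x) := by
      intro x
      simp only [star_sub, star_mul', star_sum, star_inv₀, star_natCast]
      ring
    simp only [this, Finset.sum_sub_distrib, ← Finset.mul_sum]
    rw [h1, h2]; simp
  have horth' : ∑ x, (∏ i, p (x i)) *
      (h x * star ((N : ℂ)⁻¹ * ∑ i, w (x i) - r)).re = 0 := by
    have := congrArg Complex.re horth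
    simpa only [Complex.re_sum, ← Complex.ofReal_prod, Complex.re_ofReal_mul,
      Complex.zero_re] using this
  have hexp : ∀ x, Complex.normSq (z x - r) = Complex.normSq (h x) +
      Complex.normSq ((N : ℂ)⁻¹ * ∑ i, w (x i) - r) +
      2 * (h x * star ((N : ℂ)⁻¹ * ∑ i, w (x i) - r)).re := by
    intro x
    rw [Complex.star_def, ← Complex.normSq_add]
    simp [hh]
  have : ∑ x, (∏ i, p (x i)) * Complex.normSq (z x - r) =
      ∑ x, (∏ i, p (x i)) * Complex.normSq (h x) +
      ∑ x : Fin N → ι, (∏ i, p (x i)) *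
        Complex.normSq ((N : ℂ)⁻¹ * ∑ i, w (x i) - r) := by
    simp only [hexp, mul_add, Finset.sum_add_distrib, mul_left_comm _ (2 : ℝ), ← Finset.mul_sum]
    rw [horth']; ring
  rw [this]
  refine le_add_of_nonneg_left (Finset.sum_nonneg fun x _ => ?_)
  exact mul_nonneg (Finset.prod_nonneg fun i _ => hp0 _) (Complex.normSq_nonneg _)

/-- An expectation is polynomial in the weights: if it vanishes along a ray, it vanishes along the
line. -/
lemma sum_prod_eq_zero_of_ray (g : (Fin N → ι) → ℂ) (a b : ι → ℝ)
    (h : ∀ s : ℝ, 0 ≤ s → ∑ x, (∏ i, ((a (x i) + s * b (x i) : ℝ) : ℂ)) * g x = 0) (s : ℝ) :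
    ∑ x, (∏ i, ((a (x i) + s * b (x i) : ℝ) : ℂ)) * g x = 0 := by
  let q : Polynomial ℂ := ∑ x, (∏ i, (Polynomial.C (a (x i) : ℂ) +
    Polynomial.X * Polynomial.C (b (x i) : ℂ))) * Polynomial.C (g x)
  have hq : ∀ s : ℝ, q.eval (s : ℂ) =
      ∑ x, (∏ i, ((a (x i) + s * b (x i) : ℝ) : ℂ)) * g x := by
    intro s
    simp [q, Polynomial.eval_finsetSum, Polynomial.eval_prod, mul_comm (s : ℂ)]
  have h0 : q = 0 := by
    refine Polynomial.eq_zero_of_infinite_isRoot q ?_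
    refine Set.Infinite.mono (s := Complex.ofReal '' Set.Ici 0) ?_
      ((Set.Ici_infinite (0 : ℝ)).image Complex.ofReal_injective.injOn)
    rintro _ ⟨s, hs, rfl⟩
    simp only [Set.mem_ofPred_eq, Polynomial.IsRoot.def]
    rw [hq, h s hs]
  rw [← hq, h0, Polynomial.eval_zero]

end Samples

/-! ### Hilbert-Schmidt geometry -/

section HilbertSchmidt

variable {d : ℕ}

lemma hsNormSq_eq_sum (A : Matrix (Fin d) (Fin d) ℂ) :
    hsNormSq A = ∑ a, ∑ b, Complex.normSq (A a b) := by
  rw [Finset.sum_comm]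
  simp [hsNormSq, Matrix.trace, Matrix.mul_apply, Complex.normSq_apply]

lemma hsNormSq_nonneg (A : Matrix (Fin d) (Fin d) ℂ) : 0 ≤ hsNormSq A := by
  rw [hsNormSq_eq_sum]
  exact Finset.sum_nonneg fun _ _ => Finset.sum_nonneg fun _ _ => Complex.normSq_nonneg _

lemma trace_mul_ofReal_re {A B : Matrix (Fin d) (Fin d) ℂ} (hA : A.IsHermitian)
    (hB : B.IsHermitian) : (((A * B).trace.re : ℝ) : ℂ) = (A * B).trace := by
  refine Complex.conj_eq_iff_re.1 ?_
  rw [← Complex.star_def, ← Matrix.trace_conjTranspose, Matrix.conjTranspose_mul, hA.eq, hB.eq,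
    Matrix.trace_mul_comm]

lemma trace_ofReal_re {A : Matrix (Fin d) (Fin d) ℂ} (hA : A.IsHermitian) :
    ((A.trace.re : ℝ) : ℂ) = A.trace := by
  simpa using trace_mul_ofReal_re hA Matrix.isHermitian_one

lemma hsNormSq_eq_zero {A : Matrix (Fin d) (Fin d) ℂ} (h : hsNormSq A = 0) : A = 0 := by
  refine Matrix.trace_conjTranspose_mul_self_eq_zero_iff.1 ?_
  rw [← trace_ofReal_re (Matrix.isHermitian_conjTranspose_mul_self A), ← hsNormSq, h,
    Complex.ofReal_zero]

lemma hsNormSq_of_isHermitian {A : Matrix (Fin d) (Fin d) ℂ} (hA : A.IsHermitian) :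
    hsNormSq A = (A * A).trace.re := by
  rw [hsNormSq, hA.eq]

open scoped MatrixOrder in
lemma trace_mul_re_nonneg {A B : Matrix (Fin d) (Fin d) ℂ} (hA : A.PosSemidef)
    (hB : B.PosSemidef) : 0 ≤ (A * B).trace.re := by
  obtain ⟨C, rfl⟩ := CStarAlgebra.nonneg_iff_eq_star_mul_self.mp hB.nonneg
  rw [Matrix.star_eq_conjTranspose, ← mul_assoc, Matrix.trace_mul_comm, ← mul_assoc]
  exact (Complex.nonneg_iff.1 (hA.mul_mul_conjTranspose_same C).trace_nonneg).1

lemma isHermitian_real_smul {A : Matrix (Fin d) (Fin d) ℂ} (hA : A.IsHermitian) (t : ℝ) :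
    ((t : ℂ) • A).IsHermitian := by
  rw [Matrix.IsHermitian, Matrix.conjTranspose_smul, hA.eq, Complex.star_def, Complex.conj_ofReal]

/-- A Hermitian matrix is a difference of positive ones, by `X = (X + 1)² / 4 - (X - 1)² / 4`. -/
lemma exists_posSemidef_sub {X : Matrix (Fin d) (Fin d) ℂ} (hX : X.IsHermitian) :
    ∃ A B : Matrix (Fin d) (Fin d) ℂ, A.PosSemidef ∧ B.PosSemidef ∧ X = A - B := by
  have key (Y : Matrix (Fin d) (Fin d) ℂ) (hY : Y.IsHermitian) :
      (((2 : ℂ)⁻¹ • Y) * ((2 : ℂ)⁻¹ • Y)).PosSemidef := by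
    have h := Matrix.posSemidef_conjTranspose_mul_self ((2 : ℂ)⁻¹ • Y)
    have h2 : ((2 : ℂ)⁻¹ • Y)ᴴ = (2 : ℂ)⁻¹ • Y := by
      simpa using (isHermitian_real_smul hY (2⁻¹ : ℝ)).eq
    rwa [h2] at h
  refine ⟨_, _, key (X + 1) (hX.add Matrix.isHermitian_one),
    key (X - 1) (hX.sub Matrix.isHermitian_one), ?_⟩
  simp only [smul_mul_smul_comm, ← smul_sub]
  have : (X + 1) * (X + 1) - (X - 1) * (X - 1) = (4 : ℂ) • X := by
    rw [show (4 : ℂ) • X = X + X + X + X by module]; noncomm_ring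
  rw [this, smul_smul]; norm_num

end HilbertSchmidt

namespace Measurement

/-! ### The mean estimator -/

section MeanEstimator

variable {d : ℕ} {ι : Type*}

/-- The estimator that averages the dual operators of the observed outcomes. -/
noncomputable def meanEstimator (Θ : ι → Matrix (Fin d) (Fin d) ℂ) {N : ℕ} (x : Fin N → ι) :
    Matrix (Fin d) (Fin d) ℂ :=
  (N : ℂ)⁻¹ • ∑ i, Θ (x i)

lemma meanEstimator_apply (Θ : ι → Matrix (Fin d) (Fin d) ℂ) {N : ℕ} (x : Fin N → ι)
    (a b : Fin d) : meanEstimator Θ x a b = (N : ℂ)⁻¹ * ∑ i, Θ (x i) a b := by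
  simp [meanEstimator, Matrix.sum_apply]

lemma isHermitian_meanEstimator {Θ : ι → Matrix (Fin d) (Fin d) ℂ}
    (hΘ : ∀ j, (Θ j).IsHermitian) {N : ℕ} (x : Fin N → ι) :
    (meanEstimator Θ x).IsHermitian := by
  rw [Matrix.IsHermitian, meanEstimator, Matrix.conjTranspose_smul, Matrix.conjTranspose_sum]
  simp [(hΘ _).eq]

end MeanEstimator

variable {d : ℕ} {ι : Type*} [Fintype ι] (M : Measurement d ι)

/-! ### Dual bases -/

/-- The Hermitian operators `Θ` are biorthogonal to the outcomes of the measurement with respect to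
the trace pairing. -/
structure IsDual (Θ : ι → Matrix (Fin d) (Fin d) ℂ) : Prop where
  isHermitian : ∀ j, (Θ j).IsHermitian
  trace_self : ∀ j, (M.op j * Θ j).trace = 1
  trace_of_ne : ∀ j k, j ≠ k → (M.op j * Θ k).trace = 0

variable {M}

lemma IsIC.eq_of_trace_eq (h : M.IsIC) {X Y : Matrix (Fin d) (Fin d) ℂ}
    (hXY : ∀ j, (M.op j * X).trace = (M.op j * Y).trace) : X = Y := by
  rw [Matrix.ext_iff_trace_mul_left]
  intro Z
  have hZ : Z ∈ Submodule.span ℂ (Set.range M.op) := by rw [h]; trivial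
  induction hZ using Submodule.span_induction with
  | mem z hz => obtain ⟨j, rfl⟩ := hz; exact hXY j
  | zero => simp
  | add a b _ _ ha hb => simp [add_mul, ha, hb]
  | smul c a _ ha => simp [ha]

lemma IsMinimalIC.exists_isDual (h : M.IsMinimalIC) : ∃ Θ, M.IsDual Θ := by
  classical
  let b : Module.Basis ι ℂ (Matrix (Fin d) (Fin d) ℂ) :=
    basisOfTopLeSpanOfCardEqFinrank M.op h.1.ge (by
      rw [h.2, Module.finrank_matrix]; simp [sq])
  have hb (j) : b j = M.op j := by simp [b]
  let Θ (k : ι) : Matrix (Fin d) (Fin d) ℂ := fun p q => b.coord k (Matrix.single q p 1)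
  have hΘ (X k) : (X * Θ k).trace = b.coord k X := by
    conv_rhs => rw [Matrix.matrix_eq_sum_single X]
    simp only [map_sum, Matrix.trace, Matrix.diag_apply, Matrix.mul_apply]
    refine Finset.sum_congr rfl fun p _ => Finset.sum_congr rfl fun q _ => ?_
    have : Matrix.single p q (X p q) = X p q • Matrix.single p q (1 : ℂ) := by simp
    rw [this, map_smul, smul_eq_mul]
  have hbi (j k) : (M.op j * Θ k).trace = if j = k then 1 else 0 := by
    rw [hΘ, ← hb, Module.Basis.coord_apply, Module.Basis.repr_self, Finsupp.single_apply]
  refine ⟨Θ, ⟨fun k => h.1.eq_of_trace_eq fun j => ?_, fun j => by simp [hbi],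
    fun j k hjk => by simp [hbi, hjk]⟩⟩
  rw [← (M.posSemidef j).isHermitian.eq, ← Matrix.conjTranspose_mul, Matrix.trace_conjTranspose,
    Matrix.trace_mul_comm, (M.posSemidef j).isHermitian.eq, hbi]
  split_ifs <;> simp

section Dual

variable {Θ : ι → Matrix (Fin d) (Fin d) ℂ}

lemma IsDual.trace_op_mul_sum (hΘ : M.IsDual Θ) (c : ι → ℂ) (k : ι) :
    (M.op k * ∑ j, c j • Θ j).trace = c k := by
  rw [Finset.mul_sum, Matrix.trace_sum, Finset.sum_eq_single k]
  · simp [hΘ.trace_self]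
  · intro j _ hj
    simp [hΘ.trace_of_ne k j hj.symm]
  · simp

lemma IsDual.sum_smul_eq (hΘ : M.IsDual Θ) (h : M.IsIC) (X : Matrix (Fin d) (Fin d) ℂ) :
    ∑ j, (M.op j * X).trace • Θ j = X :=
  h.eq_of_trace_eq fun k => by rw [hΘ.trace_op_mul_sum]

lemma IsDual.trace_eq_one (hΘ : M.IsDual Θ) (k : ι) : (Θ k).trace = 1 := by
  rw [← one_mul (Θ k), ← M.sum_eq_one, Finset.sum_mul, Matrix.trace_sum, Finset.sum_eq_single k]
  · exact hΘ.trace_self k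
  · intro j _ hj
    exact hΘ.trace_of_ne j k hj
  · simp

lemma IsDual.trace_op_pos (hΘ : M.IsDual Θ) (j : ι) : 0 < (M.op j).trace.re := by
  refine lt_of_le_of_ne (Complex.nonneg_iff.1 (M.posSemidef j).trace_nonneg).1 fun h => ?_
  have h0 : (M.op j).trace = 0 := by
    rw [← trace_ofReal_re (M.posSemidef j).isHermitian, ← h]; simp
  have h1 := hΘ.trace_self j
  rw [(M.posSemidef j).trace_eq_zero_iff.1 h0] at h1
  simp at h1

end Dual

variable (M)

lemma sum_trace_re : ∑ j, (M.op j).trace.re = d := by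
  rw [← Complex.re_sum, ← Matrix.trace_sum, M.sum_eq_one]; simp

/-! ### Mean square errors -/

lemma ofReal_prob {X : Matrix (Fin d) (Fin d) ℂ} (hX : X.IsHermitian) (j : ι) :
    (M.prob X j : ℂ) = (M.op j * X).trace :=
  trace_mul_ofReal_re (M.posSemidef j).isHermitian hX

lemma sum_prob {ρ : Matrix (Fin d) (Fin d) ℂ} (hρ : IsState ρ) : ∑ j, M.prob ρ j = 1 := by
  simp only [prob]
  rw [← Complex.re_sum, ← Matrix.trace_sum, ← Finset.sum_mul, M.sum_eq_one, one_mul, hρ.2]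
  simp

lemma prob_nonneg {ρ : Matrix (Fin d) (Fin d) ℂ} (hρ : ρ.PosSemidef) (j : ι) :
    0 ≤ M.prob ρ j :=
  trace_mul_re_nonneg (M.posSemidef j) hρ

variable {M}

variable {Θ : ι → Matrix (Fin d) (Fin d) ℂ} {N : ℕ}

lemma IsDual.sum_prob_mul_apply (hΘ : M.IsDual Θ) (h : M.IsIC) {ρ : Matrix (Fin d) (Fin d) ℂ}
    (hρ : ρ.IsHermitian) (a b : Fin d) : ∑ j, (M.prob ρ j : ℂ) * Θ j a b = ρ a b := by
  conv_rhs => rw [← hΘ.sum_smul_eq h ρ]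
  simp [Matrix.sum_apply, M.ofReal_prob hρ]

lemma IsDual.isUnbiased_meanEstimator (hΘ : M.IsDual Θ) (h : M.IsIC) (hN : 1 ≤ N) :
    M.IsUnbiased (meanEstimator Θ (N := N)) := by
  intro ρ hρ
  ext a b
  rw [← hΘ.sum_prob_mul_apply h hρ.1.isHermitian a b,
    ← mean_mean hN _ (by exact_mod_cast M.sum_prob hρ)]
  simp [Matrix.sum_apply, meanEstimator_apply, recordProb]

/-- The difference of an unbiased estimator and the mean estimator has expectation zero for all
real weights on the outcomes, and not only for those that come from states. -/
lemma IsUnbiased.sum_prod_mul_sub_eq_zero {est : (Fin N → ι) → Matrix (Fin d) (Fin d) ℂ}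
    (hest : M.IsUnbiased est) (hΘ : M.IsDual Θ) (h : M.IsIC) (hN : 1 ≤ N) (a b : Fin d)
    (q : ι → ℝ) :
    ∑ x, (∏ i, (q (x i) : ℂ)) * (est x a b - (N : ℂ)⁻¹ * ∑ i, Θ (x i) a b) = 0 := by
  have psd (A : Matrix (Fin d) (Fin d) ℂ) (hA : A.PosSemidef) :
      ∑ x, (∏ i, (M.prob A (x i) : ℂ)) * (est x a b - (N : ℂ)⁻¹ * ∑ i, Θ (x i) a b) = 0 := by
    by_cases h0 : A.trace = 0
    · rw [hA.trace_eq_zero_iff.1 h0]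
      refine Finset.sum_eq_zero fun x _ => ?_
      rw [Finset.prod_eq_zero (Finset.mem_univ ⟨0, hN⟩) (by simp [prob]), zero_mul]
    · set τ := A.trace.re
      have hτ : (τ : ℂ) = A.trace := trace_ofReal_re hA.isHermitian
      have hτ0 : (τ : ℂ) ≠ 0 := by rwa [hτ]
      have hτp : 0 ≤ τ := (Complex.nonneg_iff.1 hA.trace_nonneg).1
      have hs : IsState ((τ : ℂ)⁻¹ • A) := by
        refine ⟨hA.smul ?_, ?_⟩
        · rw [← Complex.ofReal_inv]; exact_mod_cast inv_nonneg.2 hτp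
        · rw [Matrix.trace_smul, ← hτ, smul_eq_mul, inv_mul_cancel₀ hτ0]
      have hp (j) : (M.prob A j : ℂ) = τ * M.prob ((τ : ℂ)⁻¹ • A) j := by
        rw [M.ofReal_prob hA.isHermitian, M.ofReal_prob hs.1.isHermitian]
        simp [hτ0]
      have h1 := congrFun (congrFun (hest _ hs) a) b
      have h2 := congrFun (congrFun (hΘ.isUnbiased_meanEstimator h hN _ hs) a) b
      simp only [Matrix.sum_apply, Matrix.smul_apply, recordProb, meanEstimator_apply,
        Complex.ofReal_prod, smul_eq_mul] at h1 h2
      simp only [hp, Finset.prod_mul_distrib, mul_sub, Finset.sum_sub_distrib, mul_assoc,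
        ← Finset.mul_sum]
      simp only [← mul_sub]
      rw [h1, h2]; simp
  have hX : (∑ j, (q j : ℂ) • Θ j).IsHermitian := by
    rw [Matrix.IsHermitian, Matrix.conjTranspose_sum]
    exact Finset.sum_congr rfl fun j _ => (isHermitian_real_smul (hΘ.isHermitian j) _).eq
  obtain ⟨A, B, hA, hB, hAB⟩ := exists_posSemidef_sub hX
  have hq (j) : q j = M.prob A j + (-1) * M.prob B j := by
    have h1 := hΘ.trace_op_mul_sum (fun j => (q j : ℂ)) j
    rw [hAB, mul_sub, Matrix.trace_sub, ← M.ofReal_prob hA.isHermitian,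
      ← M.ofReal_prob hB.isHermitian] at h1
    rw [← Complex.ofReal_inj, ← h1]; push_cast; ring
  simp only [hq]
  -- `A + s * B` is positive for `s ≥ 0`, and `s = -1` gives back the weights `q`.
  refine sum_prod_eq_zero_of_ray _ _ _ (fun s hs => ?_) (-1)
  have hAs : (A + (s : ℂ) • B).PosSemidef := hA.add (hB.smul (by exact_mod_cast hs))
  rw [← psd _ hAs]
  refine Finset.sum_congr rfl fun x _ => ?_
  congr 1
  refine Finset.prod_congr rfl fun i _ => ?_
  rw [Complex.ofReal_inj]
  simp [prob, mul_add]

lemma scaledMSE_eq_sum (est : (Fin N → ι) → Matrix (Fin d) (Fin d) ℂ)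
    (ρ : Matrix (Fin d) (Fin d) ℂ) :
    M.scaledMSE est ρ = ∑ a, ∑ b, N * ∑ x, M.recordProb ρ x *
      Complex.normSq (est x a b - ρ a b) := by
  simp only [scaledMSE, hsNormSq_eq_sum, Matrix.sub_apply, Finset.mul_sum]
  rw [Finset.sum_comm]
  refine Finset.sum_congr rfl fun a _ => ?_
  rw [Finset.sum_comm]

lemma sum_prob_mul_hsNormSq_sub (ρ : Matrix (Fin d) (Fin d) ℂ) :
    ∑ j, M.prob ρ j * hsNormSq (Θ j) - hsNormSq ρ =
      ∑ a, ∑ b, (∑ j, M.prob ρ j * Complex.normSq (Θ j a b) - Complex.normSq (ρ a b)) := by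
  simp only [hsNormSq_eq_sum, Finset.sum_sub_distrib, Finset.mul_sum]
  congr 1
  rw [Finset.sum_comm]
  refine Finset.sum_congr rfl fun a _ => ?_
  rw [Finset.sum_comm]

lemma IsDual.scaledMSE_meanEstimator (hΘ : M.IsDual Θ) (h : M.IsIC) (hN : 1 ≤ N)
    {ρ : Matrix (Fin d) (Fin d) ℂ} (hρ : IsState ρ) :
    M.scaledMSE (meanEstimator Θ (N := N)) ρ =
      ∑ j, M.prob ρ j * hsNormSq (Θ j) - hsNormSq ρ := by
  rw [scaledMSE_eq_sum, sum_prob_mul_hsNormSq_sub]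
  refine Finset.sum_congr rfl fun a _ => Finset.sum_congr rfl fun b _ => ?_
  have := scaled_variance_mean hN _ (M.sum_prob hρ) (fun j => Θ j a b)
  rw [hΘ.sum_prob_mul_apply h hρ.1.isHermitian a b] at this
  simpa only [meanEstimator_apply, recordProb] using this

/-- The mean estimator has the least error among all unbiased estimators, at every state, including
those for which some outcomes have probability zero. -/
lemma IsUnbiased.le_scaledMSE {est : (Fin N → ι) → Matrix (Fin d) (Fin d) ℂ}
    (hest : M.IsUnbiased est) (hΘ : M.IsDual Θ) (h : M.IsIC) (hN : 1 ≤ N)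
    {ρ : Matrix (Fin d) (Fin d) ℂ} (hρ : IsState ρ) :
    ∑ j, M.prob ρ j * hsNormSq (Θ j) - hsNormSq ρ ≤ M.scaledMSE est ρ := by
  rw [scaledMSE_eq_sum, sum_prob_mul_hsNormSq_sub]
  refine Finset.sum_le_sum fun a _ => Finset.sum_le_sum fun b _ => ?_
  have := mean_variance_le hN _ (M.prob_nonneg hρ.1) (M.sum_prob hρ)
    (fun j => Θ j a b) (fun x => est x a b) (hest.sum_prod_mul_sub_eq_zero hΘ h hN a b)
  rw [hΘ.sum_prob_mul_apply h hρ.1.isHermitian a b] at this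
  simpa only [recordProb] using this

end Measurement

/-! ### Rearrangements and unitary orbits -/

section Unitary

variable {d : ℕ}

lemma sum_shift_sum_mul [NeZero d] (f D : Fin d → ℝ) (σ : Equiv.Perm (Fin d)) :
    ∑ k, ∑ i, f i * D (((Equiv.addRight k).trans σ) i) = (∑ i, f i) * ∑ i, D i := by
  rw [Finset.sum_comm, Finset.sum_mul]
  refine Finset.sum_congr rfl fun i _ => ?_
  rw [← Finset.mul_sum]
  congr 1
  exact ((Equiv.addLeft i).trans σ).sum_comp D

lemma exists_perm_le_sum_mul [NeZero d] (f D : Fin d → ℝ) :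
    ∃ σ : Equiv.Perm (Fin d), (∑ i, f i) * ∑ i, D i ≤ d * ∑ i, f i * D (σ i) := by
  by_contra! h
  have h1 := Finset.sum_lt_sum_of_nonempty (s := (Finset.univ : Finset (Fin d)))
    Finset.univ_nonempty fun k _ => h ((Equiv.addRight k).trans (Equiv.refl _))
  rw [← Finset.mul_sum, sum_shift_sum_mul] at h1
  simp at h1

/-- If no rearrangement makes `∑ i, f i * D (σ i)` exceed its average over the cyclic shifts, then
all rearrangements give the same value, and comparing two that differ by a transposition shows that
`f` or `D` is constant. -/
lemma constant_or_constant_of_perm_le [NeZero d] (f D : Fin d → ℝ)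
    (h : ∀ σ : Equiv.Perm (Fin d), d * ∑ i, f i * D (σ i) ≤ (∑ i, f i) * ∑ i, D i) :
    (∀ i j, D i = D j) ∨ ∀ k l, f k = f l := by
  have heq (σ : Equiv.Perm (Fin d)) : d * ∑ i, f i * D (σ i) = (∑ i, f i) * ∑ i, D i := by
    have h1 := (Finset.sum_eq_sum_iff_of_le (s := (Finset.univ : Finset (Fin d)))
      fun k _ => h ((Equiv.addRight k).trans σ)).1 (by
        rw [← Finset.mul_sum, sum_shift_sum_mul]; simp) 0 (Finset.mem_univ _)
    simpa using h1
  by_contra! hne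
  obtain ⟨⟨i, j, hij⟩, k, l, hkl⟩ := hne
  have hij' : i ≠ j := fun e => hij (by rw [e])
  have hkl' : k ≠ l := fun e => hkl (by rw [e])
  obtain ⟨σ, hσk, hσl⟩ : ∃ σ : Equiv.Perm (Fin d), σ k = i ∧ σ l = j := by
    refine ⟨(Equiv.swap k i).trans (Equiv.swap (Equiv.swap k i l) j), ?_, ?_⟩
    · rw [Equiv.trans_apply, Equiv.swap_apply_left, Equiv.swap_apply_of_ne_of_ne _ hij']
      intro e
      exact hkl' ((Equiv.swap k i).injective (by rw [Equiv.swap_apply_left]; exact e))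
    · rw [Equiv.trans_apply, Equiv.swap_apply_left]
  have h1 := heq σ
  rw [← heq ((Equiv.swap k l).trans σ)] at h1
  have hd : (d : ℝ) ≠ 0 := Nat.cast_ne_zero.2 (NeZero.ne d)
  have h2 := mul_left_cancel₀ hd h1
  rw [← sub_eq_zero, ← Finset.sum_sub_distrib, Finset.sum_eq_add k l hkl'] at h2
  · simp only [Equiv.trans_apply, Equiv.swap_apply_left, Equiv.swap_apply_right, hσk, hσl] at h2
    have h3 : (f k - f l) * (D i - D j) = 0 := by linarith
    rcases mul_eq_zero.1 h3 with h4 | h4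
    · exact hkl (sub_eq_zero.1 h4)
    · exact hij (sub_eq_zero.1 h4)
  · intro m _ hm
    rw [Equiv.trans_apply, Equiv.swap_apply_of_ne_of_ne hm.1 hm.2, sub_self]
  · simp
  · simp

lemma conjU_mul (U V : Matrix.unitaryGroup (Fin d) ℂ) (A : Matrix (Fin d) (Fin d) ℂ) :
    conjU (U * V) A = conjU U (conjU V A) := by
  simp [conjU, mul_assoc]

lemma trace_conjU (U : Matrix.unitaryGroup (Fin d) ℂ) (A : Matrix (Fin d) (Fin d) ℂ) :
    (conjU U A).trace = A.trace := by
  rw [conjU, Matrix.trace_mul_comm, ← mul_assoc, ← Matrix.star_eq_conjTranspose,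
    Unitary.coe_star_mul_self, one_mul]

lemma conjU_mul_conjU (U : Matrix.unitaryGroup (Fin d) ℂ) (A B : Matrix (Fin d) (Fin d) ℂ) :
    conjU U A * conjU U B = conjU U (A * B) := by
  have h := Unitary.coe_star_mul_self U
  rw [Matrix.star_eq_conjTranspose] at h
  simp only [conjU, mul_assoc]
  rw [← mul_assoc _ (U : Matrix (Fin d) (Fin d) ℂ) (B * _), h, one_mul]

lemma conjU_smul_one (U : Matrix.unitaryGroup (Fin d) ℂ) (c : ℂ) :
    conjU U (c • 1) = c • 1 := by
  rw [conjU, mul_smul_comm, mul_one, smul_mul_assoc, ← Matrix.star_eq_conjTranspose,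
    Matrix.mem_unitaryGroup_iff.1 U.2]

lemma IsState.conjU {ρ : Matrix (Fin d) (Fin d) ℂ} (hρ : IsState ρ)
    (U : Matrix.unitaryGroup (Fin d) ℂ) : IsState (conjU U ρ) :=
  ⟨hρ.1.mul_mul_conjTranspose_same _, by rw [trace_conjU, hρ.2]⟩

lemma hsNormSq_conjU {ρ : Matrix (Fin d) (Fin d) ℂ} (hρ : IsState ρ)
    (U : Matrix.unitaryGroup (Fin d) ℂ) : hsNormSq (conjU U ρ) = (ρ * ρ).trace.re := by
  rw [hsNormSq_of_isHermitian (hρ.conjU U).1.isHermitian, conjU_mul_conjU, trace_conjU]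

lemma exists_conjU_diagonal {A : Matrix (Fin d) (Fin d) ℂ} (hA : A.IsHermitian) :
    ∃ (W : Matrix.unitaryGroup (Fin d) ℂ) (f : Fin d → ℝ),
      A = conjU W (Matrix.diagonal fun i => (f i : ℂ)) :=
  ⟨hA.eigenvectorUnitary, hA.eigenvalues, hA.spectral_theorem⟩

/-- The permutation matrix of `σ`, as a unitary. -/
noncomputable def permUnitary (σ : Equiv.Perm (Fin d)) : Matrix.unitaryGroup (Fin d) ℂ :=
  ⟨σ.permMatrix ℂ, by
    rw [Matrix.mem_unitaryGroup_iff, Matrix.star_eq_conjTranspose, Matrix.conjTranspose_permMatrix,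
      ← Matrix.permMatrix_mul]
    simp⟩

lemma conjU_permUnitary_diagonal (σ : Equiv.Perm (Fin d)) (D : Fin d → ℂ) :
    conjU (permUnitary σ) (Matrix.diagonal D) = Matrix.diagonal (D ∘ σ) := by
  have h : (permUnitary σ : Matrix (Fin d) (Fin d) ℂ) = σ.permMatrix ℂ := rfl
  ext i j
  rw [conjU, h, Matrix.conjTranspose_permMatrix, Matrix.mul_apply]
  simp [Matrix.mul_diagonal, Equiv.Perm.permMatrix, PEquiv.toMatrix_apply, Matrix.diagonal_apply,
    Equiv.symm_apply_eq]
  split_ifs with hij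
  · rw [hij]
  · rfl

/-- Hermitian matrices `A` and `B` pair, along the unitary orbit of `B`, to all rearranged sums of
products of their eigenvalues. -/
lemma exists_eigenvalue_pairing {A B : Matrix (Fin d) (Fin d) ℂ} (hA : A.IsHermitian)
    (hB : B.IsHermitian) :
    ∃ f D : Fin d → ℝ, ∑ i, f i = A.trace.re ∧ ∑ i, D i = B.trace.re ∧
      (∀ c : ℝ, (∀ i, f i = c) → A = (c : ℂ) • 1) ∧
      (∀ c : ℝ, (∀ i, D i = c) → B = (c : ℂ) • 1) ∧
      ∀ σ : Equiv.Perm (Fin d), ∃ U : Matrix.unitaryGroup (Fin d) ℂ,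
        (A * conjU U B).trace.re = ∑ i, f i * D (σ i) := by
  obtain ⟨W, f, rfl⟩ := exists_conjU_diagonal hA
  obtain ⟨V, D, rfl⟩ := exists_conjU_diagonal hB
  have hc (X : Matrix.unitaryGroup (Fin d) ℂ) (f : Fin d → ℝ) (c : ℝ) (h : ∀ i, f i = c) :
      conjU X (Matrix.diagonal fun i => (f i : ℂ)) = (c : ℂ) • 1 := by
    simp only [h]
    rw [← Matrix.smul_one_eq_diagonal, conjU_smul_one]
  refine ⟨f, D, by simp [trace_conjU], by simp [trace_conjU], hc W f, hc V D, fun σ =>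
    ⟨W * permUnitary σ * V⁻¹, ?_⟩⟩
  rw [← conjU_mul, inv_mul_cancel_right, conjU_mul, conjU_mul_conjU, trace_conjU,
    conjU_permUnitary_diagonal, Matrix.diagonal_mul_diagonal, Matrix.trace_diagonal]
  simp [← Complex.ofReal_mul]

/-- Some state on the unitary orbit of a state is at least as large on a Hermitian `A` as the
completely mixed state. -/
lemma exists_conjU_trace_ge [NeZero d] {A ρ : Matrix (Fin d) (Fin d) ℂ} (hA : A.IsHermitian)
    (hρ : IsState ρ) :
    ∃ U : Matrix.unitaryGroup (Fin d) ℂ, A.trace.re / d ≤ (A * conjU U ρ).trace.re := by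
  obtain ⟨f, D, hf, hD, -, -, h⟩ := exists_eigenvalue_pairing hA hρ.1.isHermitian
  obtain ⟨σ, hσ⟩ := exists_perm_le_sum_mul f D
  obtain ⟨U, hU⟩ := h σ
  refine ⟨U, ?_⟩
  rw [hf, hD, hρ.2, Complex.one_re, mul_one] at hσ
  rw [hU, div_le_iff₀' (Nat.cast_pos.2 (NeZero.pos d))]
  exact hσ

/-- If no state on the unitary orbit of a state other than the completely mixed one is larger on a
Hermitian `A` than the completely mixed state, then `A` is a multiple of the identity. -/
lemma eq_smul_one_of_conjU_trace_le [NeZero d] {A ρ : Matrix (Fin d) (Fin d) ℂ}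
    (hA : A.IsHermitian) (hρ : IsState ρ) (hne : ρ ≠ mixedState d)
    (h : ∀ U : Matrix.unitaryGroup (Fin d) ℂ, (A * conjU U ρ).trace.re ≤ A.trace.re / d) :
    ∃ c : ℝ, A = (c : ℂ) • 1 := by
  obtain ⟨f, D, hf, hD, hfc, hDc, hpair⟩ := exists_eigenvalue_pairing hA hρ.1.isHermitian
  have hd : (0 : ℝ) < d := Nat.cast_pos.2 (NeZero.pos d)
  have hle (σ : Equiv.Perm (Fin d)) : d * ∑ i, f i * D (σ i) ≤ (∑ i, f i) * ∑ i, D i := by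
    obtain ⟨U, hU⟩ := hpair σ
    rw [← hU, hf, hD, hρ.2, Complex.one_re, mul_one, ← le_div_iff₀' hd]
    exact h U
  rcases constant_or_constant_of_perm_le f D hle with hconst | hconst
  · refine absurd ?_ hne
    rw [hDc (D 0) fun i => hconst i 0, mixedState]
    congr 1
    have h1 : (d : ℝ) * D 0 = 1 := by
      rw [hρ.2, Complex.one_re] at hD
      rw [← hD, Finset.sum_congr rfl fun i _ => hconst i 0]
      simp
    rw [eq_inv_of_mul_eq_one_right h1]; simp
  · exact ⟨f 0, hfc _ fun i => hconst i 0⟩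

instance compactSpace_unitaryGroup : CompactSpace (Matrix.unitaryGroup (Fin d) ℂ) := by
  suffices h : IsCompact ((Matrix.unitaryGroup (Fin d) ℂ : Submonoid _) :
      Set (Matrix (Fin d) (Fin d) ℂ)) from isCompact_iff_compactSpace.1 h
  have hK : IsCompact (Set.univ.pi fun _ : Fin d => Set.univ.pi fun _ : Fin d =>
      Metric.closedBall (0 : ℂ) 1) :=
    isCompact_univ_pi fun _ => isCompact_univ_pi fun _ => isCompact_closedBall _ _
  have hcl : IsClosed ((Matrix.unitaryGroup (Fin d) ℂ : Submonoid _) :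
      Set (Matrix (Fin d) (Fin d) ℂ)) := by
    have : ((Matrix.unitaryGroup (Fin d) ℂ : Submonoid _) : Set (Matrix (Fin d) (Fin d) ℂ)) =
        {U | U * star U = 1} := by
      ext U; exact Matrix.mem_unitaryGroup_iff
    rw [this]
    exact isClosed_eq (by fun_prop) continuous_const
  refine IsCompact.of_isClosed_subset hK hcl fun U hU => ?_
  exact fun i _ j _ => mem_closedBall_zero_iff.2 (entry_norm_bound_of_unitary hU i j)

lemma continuous_conjU (ρ : Matrix (Fin d) (Fin d) ℂ) :
    Continuous fun U : Matrix.unitaryGroup (Fin d) ℂ => conjU U ρ := by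
  unfold conjU
  fun_prop

end Unitary

namespace Measurement

variable {d : ℕ} {ι : Type*} [Fintype ι] {M : Measurement d ι}

lemma exists_isMaxScaledMSE {N : ℕ} (est : (Fin N → ι) → Matrix (Fin d) (Fin d) ℂ)
    (ρ : Matrix (Fin d) (Fin d) ℂ) : ∃ m, M.IsMaxScaledMSE est ρ m := by
  have hc : Continuous fun U : Matrix.unitaryGroup (Fin d) ℂ =>
      M.scaledMSE est (conjU U ρ) := by
    have h1 := continuous_conjU ρ
    have h2 : Continuous fun σ : Matrix (Fin d) (Fin d) ℂ => M.scaledMSE est σ := by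
      unfold scaledMSE recordProb prob hsNormSq
      fun_prop
    exact h2.comp h1
  exact (isCompact_range hc).exists_isGreatest (Set.range_nonempty _)

end Measurement

namespace Measurement

/-! ### The frame bound and its equality case -/

section FrameBound

variable {d : ℕ} {ι : Type*} [Fintype ι]

/-- The deviation of the dual operator `Θ j` from `t` times the normalized outcome
`Π_j / tr Π_j`, both taken relative to the completely mixed state. -/
noncomputable def dualDefect (M : Measurement d ι) (Θ : ι → Matrix (Fin d) (Fin d) ℂ) (t : ℝ)
    (j : ι) : Matrix (Fin d) (Fin d) ℂ :=
  Θ j - ((t / (M.op j).trace.re : ℝ) : ℂ) • M.op j + (((t - 1) / d : ℝ) : ℂ) • 1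

variable {M : Measurement d ι} {Θ : ι → Matrix (Fin d) (Fin d) ℂ}

lemma IsDual.hsNormSq_dualDefect (hΘ : M.IsDual Θ) (hd : d ≠ 0) (t : ℝ) (j : ι) :
    hsNormSq (M.dualDefect Θ t j) = hsNormSq (Θ j) - 2 * t / (M.op j).trace.re
      + t ^ 2 * M.purity j - (t - 1) ^ 2 / d := by
  have hdr : (d : ℝ) ≠ 0 := by exact_mod_cast hd
  have hH := (M.posSemidef j).isHermitian
  have ha := (hΘ.trace_op_pos j).ne'
  rw [dualDefect, hsNormSq_of_isHermitian (((hΘ.isHermitian j).sub (isHermitian_real_smul hH _)).add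
    (isHermitian_real_smul Matrix.isHermitian_one _)), hsNormSq_of_isHermitian (hΘ.isHermitian j)]
  have h1 : (Θ j * M.op j).trace = 1 := by rw [Matrix.trace_mul_comm, hΘ.trace_self]
  simp only [add_mul, mul_add, sub_mul, mul_sub, smul_mul_assoc, mul_smul_comm,
    Matrix.trace_add, Matrix.trace_sub, Matrix.trace_smul, mul_one, one_mul, h1, hΘ.trace_self,
    hΘ.trace_eq_one, Matrix.trace_one, Fintype.card_fin, smul_eq_mul, Complex.add_re,
    Complex.sub_re, Complex.re_ofReal_mul, Complex.ofReal_re, Complex.natCast_re, purity]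
  field_simp
  ring

/-- The sum of the defects is a quadratic polynomial in `t`, with coefficients given by the mean
square error at the completely mixed state, the dimension, and the average purity. -/
lemma IsDual.sum_hsNormSq_dualDefect (hΘ : M.IsDual Θ) (hM : M.IsMinimalIC) (hd : d ≠ 0)
    (t : ℝ) :
    ∑ j, (M.op j).trace.re * hsNormSq (M.dualDefect Θ t j) =
      (∑ j, (M.op j).trace.re * hsNormSq (Θ j) - 1) - 2 * t * ((d : ℝ) ^ 2 - 1)
        + t ^ 2 * (d * M.avgPurity - 1) := by
  have hdr : (d : ℝ) ≠ 0 := by exact_mod_cast hd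
  have hp : ∑ j, (M.op j).trace.re * M.purity j = d * M.avgPurity := by
    rw [avgPurity, Finset.mul_sum]
    exact Finset.sum_congr rfl fun j _ => by field_simp
  have h1 (j : ι) : (M.op j).trace.re * hsNormSq (M.dualDefect Θ t j) =
      (M.op j).trace.re * hsNormSq (Θ j) - 2 * t + t ^ 2 * ((M.op j).trace.re * M.purity j)
        - (M.op j).trace.re * ((t - 1) ^ 2 / d) := by
    rw [hΘ.hsNormSq_dualDefect hd]
    have ha := (hΘ.trace_op_pos j).ne'
    field_simp
  simp only [h1, Finset.sum_sub_distrib, Finset.sum_add_distrib, ← Finset.mul_sum,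
    ← Finset.sum_mul, hp, M.sum_trace_re, Finset.sum_const, Finset.card_univ, hM.2, nsmul_eq_mul]
  push_cast
  field_simp
  ring

lemma IsDual.sum_hsNormSq_dualDefect_nonneg (hΘ : M.IsDual Θ) (t : ℝ) :
    0 ≤ ∑ j, (M.op j).trace.re * hsNormSq (M.dualDefect Θ t j) :=
  Finset.sum_nonneg fun j _ => mul_nonneg (hΘ.trace_op_pos j).le (hsNormSq_nonneg _)

lemma IsDual.avgPurity_pos (hΘ : M.IsDual Θ) (hM : M.IsMinimalIC) (hd : 2 ≤ d) :
    0 < d * M.avgPurity - 1 := by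
  have hB : (0 : ℝ) < (d : ℝ) ^ 2 - 1 := by
    have : (2 : ℝ) ≤ d := by exact_mod_cast hd
    nlinarith
  by_contra! h
  -- Otherwise the nonnegative quadratic polynomial in `t` would tend to `-∞` for large `t`.
  set A := ∑ j, (M.op j).trace.re * hsNormSq (Θ j) - 1 with hA
  have h1 := hΘ.sum_hsNormSq_dualDefect_nonneg ((|A| + 1) / (2 * ((d : ℝ) ^ 2 - 1)))
  rw [hΘ.sum_hsNormSq_dualDefect hM (by lia), ← hA] at h1
  have h2 : 2 * ((|A| + 1) / (2 * ((d : ℝ) ^ 2 - 1))) * ((d : ℝ) ^ 2 - 1) = |A| + 1 := by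
    field_simp
  rw [h2] at h1
  have h3 := mul_nonpos_of_nonneg_of_nonpos
    (sq_nonneg ((|A| + 1) / (2 * ((d : ℝ) ^ 2 - 1)))) h
  linarith [le_abs_self A]

lemma mseBound_denom (M : Measurement d ι) :
    (d : ℝ) ^ 2 * M.avgPurity - d = d * (d * M.avgPurity - 1) := by ring

/-- The operator whose expectation, up to the purity of the state, is the error of the mean
estimator. -/
noncomputable def errorOperator (M : Measurement d ι) (Θ : ι → Matrix (Fin d) (Fin d) ℂ) :
    Matrix (Fin d) (Fin d) ℂ :=
  ∑ j, (hsNormSq (Θ j) : ℂ) • M.op j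

lemma isHermitian_errorOperator : (M.errorOperator Θ).IsHermitian := by
  rw [Matrix.IsHermitian, errorOperator, Matrix.conjTranspose_sum]
  exact Finset.sum_congr rfl fun j _ => (isHermitian_real_smul (M.posSemidef j).isHermitian _).eq

lemma trace_errorOperator_mul (X : Matrix (Fin d) (Fin d) ℂ) :
    (M.errorOperator Θ * X).trace.re = ∑ j, M.prob X j * hsNormSq (Θ j) := by
  rw [errorOperator, Finset.sum_mul, Matrix.trace_sum, Complex.re_sum]
  refine Finset.sum_congr rfl fun j _ => ?_
  rw [smul_mul_assoc, Matrix.trace_smul, smul_eq_mul, Complex.re_ofReal_mul, mul_comm, prob]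

lemma trace_errorOperator :
    (M.errorOperator Θ).trace.re = ∑ j, (M.op j).trace.re * hsNormSq (Θ j) := by
  rw [← mul_one (M.errorOperator Θ), trace_errorOperator_mul]
  simp [prob]

/-- At the minimizing value of `t`, the sum of the defects is `d` times the gap between the error
of the mean estimator, averaged over a unitary orbit, and the tomographic bound. -/
lemma IsDual.sum_hsNormSq_dualDefect_min (hΘ : M.IsDual Θ) (hM : M.IsMinimalIC) (hd : 2 ≤ d)
    (ρ : Matrix (Fin d) (Fin d) ℂ) :
    ∑ j, (M.op j).trace.re *
        hsNormSq (M.dualDefect Θ (((d : ℝ) ^ 2 - 1) / (d * M.avgPurity - 1)) j) =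
      d * ((M.errorOperator Θ).trace.re / d - (ρ * ρ).trace.re - M.mseBound ρ) := by
  have hC := (hΘ.avgPurity_pos hM hd).ne'
  have hdr : (d : ℝ) ≠ 0 := by exact_mod_cast (by lia : d ≠ 0)
  rw [hΘ.sum_hsNormSq_dualDefect hM (by lia), trace_errorOperator, mseBound, mseBound_denom]
  field_simp
  ring

/-- If the error operator is a multiple of the identity, the dual operators have the same norm. -/
lemma IsDual.hsNormSq_eq_of_errorOperator (hΘ : M.IsDual Θ) {c : ℝ}
    (h : M.errorOperator Θ = (c : ℂ) • 1) (j : ι) : hsNormSq (Θ j) = c := by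
  have h1 := congrArg (fun X => (X * Θ j).trace) h
  simp only [errorOperator, Finset.sum_mul, Matrix.trace_sum, smul_mul_assoc, Matrix.trace_smul,
    one_mul, hΘ.trace_eq_one, smul_eq_mul, mul_one] at h1
  rw [Finset.sum_eq_single j (fun k _ hk => by rw [hΘ.trace_of_ne k j hk, mul_zero]) (by simp),
    hΘ.trace_self, mul_one] at h1
  exact_mod_cast h1

/-- If the dual operators are affine functions of the outcomes and have the same norm, then the
measurement is a generalized SIC. -/
lemma IsDual.isGeneralizedSIC (hΘ : M.IsDual Θ) (hM : M.IsMinimalIC) (hd : d ≠ 0) {t c : ℝ}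
    (ht : 0 < t) (h : ∀ j, M.dualDefect Θ t j = 0) (hc : ∀ j, hsNormSq (Θ j) = c) :
    M.IsGeneralizedSIC := by
  have hdr : (d : ℝ) ≠ 0 := by exact_mod_cast hd
  have hdc : (d : ℂ) ≠ 0 := by exact_mod_cast hd
  have htc : (t : ℂ) ≠ 0 := by exact_mod_cast ht.ne'
  have hΘeq (j) : Θ j = ((t / (M.op j).trace.re : ℝ) : ℂ) • M.op j -
      (((t - 1) / d : ℝ) : ℂ) • 1 := by
    rw [← sub_eq_zero, ← h j, dualDefect]; abel
  have hnorm (j) : t / (M.op j).trace.re = c + (t - 1) / d := by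
    have h1 : ((hsNormSq (Θ j) : ℝ) : ℂ) = (Θ j * Θ j).trace := by
      rw [hsNormSq_of_isHermitian (hΘ.isHermitian j),
        trace_mul_ofReal_re (hΘ.isHermitian j) (hΘ.isHermitian j)]
    have h2 : (Θ j * Θ j).trace = ((t / (M.op j).trace.re : ℝ) : ℂ) - (((t - 1) / d : ℝ) : ℂ) := by
      nth_rewrite 1 [hΘeq j]
      rw [sub_mul, Matrix.trace_sub, smul_mul_assoc, smul_mul_assoc, one_mul, Matrix.trace_smul,
        Matrix.trace_smul, hΘ.trace_self, hΘ.trace_eq_one]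
      simp
    rw [hc, h2] at h1
    have h3 : c = t / (M.op j).trace.re - (t - 1) / d := by exact_mod_cast h1
    rw [h3]; ring
  have ha (j) : (M.op j).trace.re = 1 / d := by
    have hall (k) : (M.op k).trace.re = (M.op j).trace.re := by
      have h1 := (hnorm k).trans (hnorm j).symm
      have hk := hΘ.trace_op_pos k
      have hj := hΘ.trace_op_pos j
      rw [div_eq_div_iff hk.ne' hj.ne'] at h1
      exact (mul_left_cancel₀ ht.ne' h1).symm
    have h1 := M.sum_trace_re
    simp only [hall, Finset.sum_const, Finset.card_univ, hM.2, nsmul_eq_mul] at h1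
    push_cast at h1
    field_simp
    have : (d : ℝ) * (d * (M.op j).trace.re) = d * 1 := by linarith
    linarith [mul_left_cancel₀ hdr this]
  have hac (j) : (M.op j).trace = 1 / d := by
    rw [← trace_ofReal_re (M.posSemidef j).isHermitian, ha]; simp
  have htr (j k) : (M.op j * Θ k).trace = t * d * (M.op j * M.op k).trace - (t - 1) / d ^ 2 := by
    rw [hΘeq, mul_sub, Matrix.trace_sub, mul_smul_comm, mul_smul_comm, Matrix.trace_smul,
      Matrix.trace_smul, mul_one, ha, hac]
    simp only [smul_eq_mul]
    push_cast
    field_simp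
  refine ⟨hM.1, d / t, (t - 1) / (d * t), fun j => ?_, fun j k hjk => ?_⟩
  · have h1 := htr j j
    rw [hΘ.trace_self] at h1
    simp only [smul_mul_smul_comm, Matrix.trace_smul, smul_eq_mul]
    push_cast
    field_simp at h1 ⊢
    linear_combination -h1
  · have h1 := htr j k
    rw [hΘ.trace_of_ne j k hjk] at h1
    simp only [smul_mul_smul_comm, Matrix.trace_smul, smul_eq_mul]
    push_cast
    field_simp at h1 ⊢
    linear_combination -h1

/-- For a generalized SIC the dual operators have the same norm, and it matches the tomographic
bound. -/
lemma IsGeneralizedSIC.hsNormSq_sub (hSIC : M.IsGeneralizedSIC) (hΘ : M.IsDual Θ)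
    (hM : M.IsMinimalIC) (hd : 2 ≤ d) (ρ : Matrix (Fin d) (Fin d) ℂ) (j : ι) :
    hsNormSq (Θ j) - (ρ * ρ).trace.re = M.mseBound ρ := by
  classical
  obtain ⟨hIC, α, ζ, hdiag, hoff⟩ := hSIC
  have hd0 : d ≠ 0 := by lia
  have hdr : (d : ℝ) ≠ 0 := by exact_mod_cast hd0
  have hdc : (d : ℂ) ≠ 0 := by exact_mod_cast hd0
  have hgram (j k) : (d : ℂ) ^ 2 * (M.op j * M.op k).trace = ζ + if j = k then (α : ℂ) else 0 := by
    have h1 : (d : ℂ) ^ 2 * (M.op j * M.op k).trace =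
        (((d : ℂ) • M.op j) * ((d : ℂ) • M.op k)).trace := by
      simp only [smul_mul_smul_comm, Matrix.trace_smul, smul_eq_mul]; ring
    rw [h1]
    split_ifs with hjk
    · subst hjk
      rw [hdiag]; push_cast; ring
    · rw [hoff j k hjk, add_zero]
  have htr (j) : (d : ℂ) ^ 2 * (M.op j).trace = d ^ 2 * ζ + α := by
    rw [← mul_one (M.op j), ← M.sum_eq_one, Finset.mul_sum, Matrix.trace_sum, Finset.mul_sum]
    simp only [hgram, Finset.sum_add_distrib, Finset.sum_const, Finset.card_univ, hM.2,
      nsmul_eq_mul, Finset.sum_ite_eq, Finset.mem_univ, if_true]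
    push_cast; ring
  have hsum : (d : ℂ) ^ 2 * ζ + α = d := by
    have h1 : ∑ j, (d : ℂ) ^ 2 * (M.op j).trace = d ^ 2 * d := by
      rw [← Finset.mul_sum, ← Matrix.trace_sum, M.sum_eq_one]; simp
    simp only [htr, Finset.sum_const, Finset.card_univ, hM.2, nsmul_eq_mul] at h1
    push_cast at h1
    exact mul_left_cancel₀ (pow_ne_zero 2 hdc) h1
  have hsumr : (d : ℝ) ^ 2 * ζ + α = d := by exact_mod_cast hsum
  have hac (j) : (M.op j).trace = 1 / d := by
    have h1 := htr j
    rw [hsum] at h1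
    field_simp
    have : (d : ℂ) * (d * (M.op j).trace) = d * 1 := by linear_combination h1
    linear_combination mul_left_cancel₀ hdc this
  have ha (j) : (M.op j).trace.re = 1 / d := by
    rw [hac, ← Complex.ofReal_natCast, ← Complex.ofReal_one, ← Complex.ofReal_div,
      Complex.ofReal_re]
  have hpur : M.avgPurity = α + ζ := by
    have h1 (j) : (d : ℝ) ^ 2 * (M.op j * M.op j).trace.re = α + ζ := by
      have h2 := hgram j j
      rw [if_pos rfl, ← trace_mul_ofReal_re (M.posSemidef j).isHermitian
        (M.posSemidef j).isHermitian] at h2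
      have h3 : (d : ℝ) ^ 2 * (M.op j * M.op j).trace.re = ζ + α := by exact_mod_cast h2
      rw [h3, add_comm]
    have h2 (j) : M.purity j = α + ζ := by
      rw [purity, ha, ← h1 j]; field_simp
    simp only [avgPurity, h2, ← Finset.sum_mul, ← Finset.sum_div, M.sum_trace_re]
    rw [div_self hdr, one_mul]
  have hB : (0 : ℝ) < (d : ℝ) ^ 2 - 1 := by
    have : (2 : ℝ) ≤ d := by exact_mod_cast hd
    nlinarith
  have hden : (d : ℝ) ^ 2 * M.avgPurity - d = (d ^ 2 - 1) * α := by
    rw [hpur]; linear_combination hsumr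
  have hα : α ≠ 0 := by
    rintro rfl
    have h1 := hΘ.avgPurity_pos hM hd
    rw [mseBound_denom, mul_zero] at hden
    exact h1.ne' ((mul_eq_zero.1 hden).resolve_left hdr)
  have hαc : (α : ℂ) ≠ 0 := by exact_mod_cast hα
  -- The dual operators are affine functions of the outcomes.
  have hΘeq : Θ j = ((d : ℂ) ^ 2 / α) • M.op j - ((d : ℂ) * ζ / α) • 1 := by
    refine hIC.eq_of_trace_eq fun k => ?_
    have h1 := hgram k j
    rw [mul_sub, Matrix.trace_sub, mul_smul_comm, mul_smul_comm, Matrix.trace_smul,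
      Matrix.trace_smul, mul_one, hac, smul_eq_mul, smul_eq_mul]
    by_cases hkj : k = j
    · subst hkj
      rw [if_pos rfl] at h1
      rw [hΘ.trace_self]
      field_simp
      linear_combination -h1
    · rw [if_neg hkj] at h1
      rw [hΘ.trace_of_ne k j hkj]
      field_simp
      linear_combination -h1
  have hκ : hsNormSq (Θ j) = (d ^ 2 - d * ζ) / α := by
    rw [hsNormSq_of_isHermitian (hΘ.isHermitian j)]
    nth_rewrite 1 [hΘeq]
    rw [sub_mul, Matrix.trace_sub, smul_mul_assoc, smul_mul_assoc, one_mul, Matrix.trace_smul,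
      Matrix.trace_smul, hΘ.trace_self, hΘ.trace_eq_one, smul_eq_mul, smul_eq_mul, mul_one,
      mul_one, ← sub_div]
    have : ((d : ℂ) ^ 2 - d * ζ) / α = (((d ^ 2 - d * ζ) / α : ℝ) : ℂ) := by push_cast; rfl
    rw [this, Complex.ofReal_re]
  rw [hκ, mseBound, hden]
  field_simp
  linear_combination -hsumr

end FrameBound

end Measurement

end Tomography

theorem theorem3 (d : ℕ) (hd : 2 ≤ d) {ι : Type*} [Fintype ι]
    (M : Tomography.Measurement d ι) (hM : M.IsMinimalIC) (N : ℕ) (hN : 1 ≤ N) :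
    -- the denominator of the bound is positive
    0 < (d : ℝ) ^ 2 * M.avgPurity - d ∧
    -- the lower bound, for every unbiased estimator and every state
    (∀ est : (Fin N → ι) → Matrix (Fin d) (Fin d) ℂ, M.IsUnbiased est →
      ∀ ρ : Matrix (Fin d) (Fin d) ℂ, Tomography.IsState ρ →
        ∃ m : ℝ, M.IsMaxScaledMSE est ρ m ∧ M.mseBound ρ ≤ m) ∧
    -- a generalized SIC saturates it, with one estimator for all states
    (M.IsGeneralizedSIC →
      ∃ est : (Fin N → ι) → Matrix (Fin d) (Fin d) ℂ,
        (∀ x, (est x).IsHermitian) ∧ M.IsUnbiased est ∧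
        ∀ ρ : Matrix (Fin d) (Fin d) ℂ, Tomography.IsState ρ →
          M.IsMaxScaledMSE est ρ (M.mseBound ρ)) ∧
    -- saturation at any state other than the completely mixed one characterizes generalized SICs
    (∀ ρ : Matrix (Fin d) (Fin d) ℂ, Tomography.IsState ρ → ρ ≠ Tomography.mixedState d →
      ((∃ est : (Fin N → ι) → Matrix (Fin d) (Fin d) ℂ,
          M.IsUnbiased est ∧ M.IsMaxScaledMSE est ρ (M.mseBound ρ)) ↔
        M.IsGeneralizedSIC)) := by
  open Tomography Tomography.Measurement in
  have : NeZero d := ⟨by lia⟩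
  have hd0 : (0 : ℝ) < d := by exact_mod_cast (by lia : 0 < d)
  obtain ⟨Θ, hΘ⟩ := hM.exists_isDual
  have hC := hΘ.avgPurity_pos hM hd
  have hSIC : M.IsGeneralizedSIC →
      ∃ est : (Fin N → ι) → Matrix (Fin d) (Fin d) ℂ,
        (∀ x, (est x).IsHermitian) ∧ M.IsUnbiased est ∧
        ∀ ρ : Matrix (Fin d) (Fin d) ℂ, IsState ρ → M.IsMaxScaledMSE est ρ (M.mseBound ρ) := by
    intro h
    refine ⟨meanEstimator Θ, isHermitian_meanEstimator hΘ.isHermitian,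
      hΘ.isUnbiased_meanEstimator hM.1 hN, fun ρ hρ => ?_⟩
    have hU (U : Matrix.unitaryGroup (Fin d) ℂ) :
        M.scaledMSE (meanEstimator Θ (N := N)) (conjU U ρ) = M.mseBound ρ := by
      have hnorm (j) : hsNormSq (Θ j) = M.mseBound ρ + (ρ * ρ).trace.re := by
        rw [← h.hsNormSq_sub hΘ hM hd ρ j]; ring
      rw [hΘ.scaledMSE_meanEstimator hM.1 hN (hρ.conjU U), hsNormSq_conjU hρ]
      simp only [hnorm]
      rw [← Finset.sum_mul, M.sum_prob (hρ.conjU U)]; ring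
    refine ⟨⟨1, hU 1⟩, ?_⟩
    rintro _ ⟨U, rfl⟩
    exact (hU U).le
  have hgap (ρ : Matrix (Fin d) (Fin d) ℂ) (hρ : IsState ρ) :
      M.mseBound ρ ≤ (M.errorOperator Θ).trace.re / d - (ρ * ρ).trace.re := by
    have h1 := hΘ.sum_hsNormSq_dualDefect_nonneg
      (((d : ℝ) ^ 2 - 1) / (d * M.avgPurity - 1))
    rw [hΘ.sum_hsNormSq_dualDefect_min hM hd ρ] at h1
    linarith [nonneg_of_mul_nonneg_right h1 hd0]
  have hle (est : (Fin N → ι) → Matrix (Fin d) (Fin d) ℂ) (hest : M.IsUnbiased est)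
      (ρ : Matrix (Fin d) (Fin d) ℂ) (hρ : IsState ρ) (U : Matrix.unitaryGroup (Fin d) ℂ) :
      (M.errorOperator Θ * conjU U ρ).trace.re - (ρ * ρ).trace.re ≤
        M.scaledMSE est (conjU U ρ) := by
    rw [trace_errorOperator_mul, ← hsNormSq_conjU hρ U]
    exact hest.le_scaledMSE hΘ hM.1 hN (hρ.conjU U)
  refine ⟨by rw [mseBound_denom]; positivity, fun est hest ρ hρ => ?_, hSIC, fun ρ hρ hne =>
    ⟨?_, fun h => ?_⟩⟩
  · obtain ⟨m, hm⟩ := exists_isMaxScaledMSE (M := M) est ρ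
    obtain ⟨U, hU⟩ := exists_conjU_trace_ge (isHermitian_errorOperator (M := M) (Θ := Θ)) hρ
    exact ⟨m, hm, by linarith [hm.2 ⟨U, rfl⟩, hgap ρ hρ, hle est hest ρ hρ U]⟩
  · rintro ⟨est, hest, hmax⟩
    have hup (U : Matrix.unitaryGroup (Fin d) ℂ) :
        (M.errorOperator Θ * conjU U ρ).trace.re - (ρ * ρ).trace.re ≤ M.mseBound ρ :=
      (hle est hest ρ hρ U).trans (hmax.2 ⟨U, rfl⟩)
    obtain ⟨c, hc⟩ := eq_smul_one_of_conjU_trace_le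
      (isHermitian_errorOperator (M := M) (Θ := Θ)) hρ hne
      (fun U => by linarith [hup U, hgap ρ hρ])
    obtain ⟨U, hU⟩ := exists_conjU_trace_ge (isHermitian_errorOperator (M := M) (Θ := Θ)) hρ
    have hzero := hΘ.sum_hsNormSq_dualDefect_min hM hd ρ
    rw [le_antisymm (by linarith [hup U] :
      (M.errorOperator Θ).trace.re / d - (ρ * ρ).trace.re ≤ M.mseBound ρ) (hgap ρ hρ), sub_self,
      mul_zero, Finset.sum_eq_zero_iff_of_nonneg fun j _ =>
        mul_nonneg (hΘ.trace_op_pos j).le (hsNormSq_nonneg _)] at hzero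
    refine hΘ.isGeneralizedSIC hM (by lia) (t := ((d : ℝ) ^ 2 - 1) / (d * M.avgPurity - 1))
      (div_pos ?_ hC) (fun j => hsNormSq_eq_zero ?_) (hΘ.hsNormSq_eq_of_errorOperator hc)
    · have : (2 : ℝ) ≤ d := by exact_mod_cast hd
      nlinarith
    · exact (mul_eq_zero.1 (hzero j (Finset.mem_univ _))).resolve_left (hΘ.trace_op_pos j).ne'
  · obtain ⟨est, -, hest, hmax⟩ := hSIC h
    exact ⟨est, hest, hmax ρ hρ⟩
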